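/- There are absolute constants $c>0$ and $C>0$ such that the following holds for every positive integer $d$ and every real $\varepsilon$ with $2^{-d/3}<\varepsilon<1/170$. There exist two (Borel) probability distributions $D_1,D_2$ on the torus $\mathbb{T}^d=(\mathbb{R}/\mathbb{Z})^d$ such that: (a) for every $\ell\in\mathbb{Z}^d$ with $\|\ell\|_1\le c\sqrt{d/\log(1/\varepsilon)}$, $$\left|\widehat{D_1}(\ell)-\widehat{D_2}(\ell)\right|\le 2^{-C\sqrt{d\log(1/\varepsilon)}};$$ (b) $\mathrm{d}_{\mathrm{HH}}^{(0.49)}(D_1,D_2)>\varepsilon$. Here $\log$ is the natural logarithm and $\widehat{D}(\ell)=\int_{\mathbb{T}^d}e^{2\pi i\,\ell\cdot x}\,dD(x)$. Let $\mathrm{d}_{\mathrm{tor}}(x,y)=\big(\sum_{i=1}^d \mathrm{d}(x_i,y_i)^2\big)^{1/2}$, where $\mathrm{d}(x_i,y_i)=\min_{k\in\mathbb{Z}}|x_i-y_i-k|$, and $\mathrm{Ball}(x,\tau)=\{y\in\mathbb{T}^d:\mathrm{d}_{\mathrm{tor}}(x,y)\le\tau\}$. For $0<s<1$, the heavy hitter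 distance $\mathrm{d}_{\mathrm{HH}}^{(s)}(D_1,D_2)$ at scale $s$ is the smallest $\eta\ge 0$ such that for all $0\le\tau\le s$ and all $x\in\mathbb{T}^d$, $$D_1(\mathrm{Ball}(x,\tau))\le D_2(\mathrm{Ball}(x,\tau+s))+\eta\quad\text{and}\quad D_2(\mathrm{Ball}(x,\tau))\le D_1(\mathrm{Ball}(x,\tau+s))+\eta.$$ -/

import Mathlib

open MeasureTheory

noncomputable section

/-- The Euclidean toroidal distance on the `d`-dimensional torus `(ℝ/ℤ)^d`. The distance of
`UnitAddCircle = ℝ/ℤ` is the one-dimensional toroidal distance: for representatives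
`0 ≤ a < b < 1` it equals `min (b - a) (a + (1 - b))`. -/
def torDist {d : ℕ} (x y : UnitAddTorus (Fin d)) : ℝ :=
  Real.sqrt (∑ i, dist (x i) (y i) ^ 2)

/-- The closed ball of radius `τ` around `x` for the toroidal distance. -/
def torBall {d : ℕ} (x : UnitAddTorus (Fin d)) (τ : ℝ) : Set (UnitAddTorus (Fin d)) :=
  {y | torDist x y ≤ τ}

/-- The `ℓ`-th Fourier coefficient `∫ exp (2 π i (ℓ · x)) dD(x)` of a probability distribution
on the torus. -/
def torFourierCoeff {d : ℕ} (D : ProbabilityMeasure (UnitAddTorus (Fin d))) (l : Fin d → ℤ) : ℂ :=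
  ∫ x, UnitAddTorus.mFourier l x ∂(D : Measure (UnitAddTorus (Fin d)))

/-- The admissible errors in the definition of the heavy hitter distance at scale `s`: the
`η ≥ 0` such that every ball of radius `τ ∈ [0, s]` has, under either distribution, at most `η`
more mass than the ball with the same centre and radius `τ + s` has under the other one. -/
def heavyHitterErrors {d : ℕ} (s : ℝ) (D₁ D₂ : ProbabilityMeasure (UnitAddTorus (Fin d))) :
    Set ℝ :=
  {η | 0 ≤ η ∧ ∀ τ : ℝ, 0 ≤ τ → τ ≤ s → ∀ x : UnitAddTorus (Fin d),
    (D₁ : Measure (UnitAddTorus (Fin d))).real (torBall x τ) ≤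
        (D₂ : Measure (UnitAddTorus (Fin d))).real (torBall x (τ + s)) + η ∧
    (D₂ : Measure (UnitAddTorus (Fin d))).real (torBall x τ) ≤
        (D₁ : Measure (UnitAddTorus (Fin d))).real (torBall x (τ + s)) + η}

/-- The heavy hitter distance at scale `s`: the smallest admissible error (the infimum is
attained, see `isLeast_heavyHitterDist`). -/
def heavyHitterDist {d : ℕ} (s : ℝ) (D₁ D₂ : ProbabilityMeasure (UnitAddTorus (Fin d))) : ℝ :=
  sInf (heavyHitterErrors s D₁ D₂)

theorem isLeast_heavyHitterDist {d : ℕ} (s : ℝ)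
    (D₁ D₂ : ProbabilityMeasure (UnitAddTorus (Fin d))) :
    IsLeast (heavyHitterErrors s D₁ D₂) (heavyHitterDist s D₁ D₂) := by
  have hne : (heavyHitterErrors s D₁ D₂).Nonempty := by
    refine ⟨1, zero_le_one, fun τ _ _ x => ⟨?_, ?_⟩⟩
    · exact le_add_of_nonneg_of_le measureReal_nonneg measureReal_le_one
    · exact le_add_of_nonneg_of_le measureReal_nonneg measureReal_le_one
  have hbd : BddBelow (heavyHitterErrors s D₁ D₂) := ⟨0, fun η h => h.1⟩
  refine ⟨⟨le_csInf hne fun η h => h.1, fun τ h0 h1 x => ⟨?_, ?_⟩⟩, fun η h => csInf_le hbd h⟩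
  · rw [← sub_le_iff_le_add']
    exact le_csInf hne fun η h => sub_le_iff_le_add'.2 (h.2 τ h0 h1 x).1
  · rw [← sub_le_iff_le_add']
    exact le_csInf hne fun η h => sub_le_iff_le_add'.2 (h.2 τ h0 h1 x).2

end

/-! Let each coordinate independently be `1 / 2` with probability `p`, and `0` otherwise. The
coefficient at `l` is `(1 - 2p) ^ n`, with `n` the number of odd entries of `l`: a polynomial in `p`
of degree `n`. A ball around `0` of radius below `1 / 2` sees only the origin and has mass `(1 - p)
^ d`, which is `1` at `p = 0` and tiny once `p * d ≥ 4`. A signed measure in `p` that annihilates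
degree at most `m` and has a large atom at `0` (`exists_annihilating_weights`) therefore gives,
through its positive and negative parts, two mixtures whose low coefficients agree exactly while
their masses near `0` differ by `1 / 5` (`exists_indistinguishable`). The nodes fit into `p ≤ 1` for
`m` up to about `√d / 4`. -/

/-! ### Signed measures annihilating low-degree polynomials. -/

theorem one_le_sq_natCast_sub {k m : ℕ} (h : k ≠ m) : (1 : ℝ) ≤ ((k : ℝ) - m) ^ 2 := by
  have h1 : (1 : ℤ) ≤ |(k : ℤ) - m| := Int.one_le_abs (sub_ne_zero.2 (by exact_mod_cast h))
  rw [one_le_sq_iff_one_le_abs]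
  exact_mod_cast h1

open Polynomial in
/-- An alternating binomial sum over the squares `(k - m) ^ 2` kills the polynomials of degree
less than `m`. -/
theorem sum_alternating_choose_eval_sq_eq_zero {m : ℕ} (q : ℝ[X]) (hq : q.natDegree < m) :
    ∑ k ∈ Finset.range (2 * m + 1),
      (-1 : ℝ) ^ k * (2 * m).choose k * q.eval (((k : ℝ) - m) ^ 2) = 0 := by
  -- The square doubles the degree, so the `2 * m`-th finite difference vanishes.
  have hdeg : (q.comp ((X - C (m : ℝ)) ^ 2)).natDegree < 2 * m := by
    rw [natDegree_comp, natDegree_pow, natDegree_X_sub_C]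
    omega
  have h := congr_fun (fwdDiff_iter_eq_zero_of_degree_lt hdeg) 0
  rw [fwdDiff_iter_eq_sum_shift] at h
  rw [← Pi.zero_apply (M := fun _ : ℝ => ℝ) 0, ← h]
  refine Finset.sum_congr rfl fun k hk => ?_
  have hk' : k ≤ 2 * m := Nat.lt_succ_iff.1 (Finset.mem_range.1 hk)
  have hsign : (-1 : ℝ) ^ (2 * m - k) = (-1) ^ k := by
    have h2 : (-1 : ℝ) ^ (2 * m - k) * (-1) ^ k = 1 := by
      rw [← pow_add, Nat.sub_add_cancel hk', pow_mul]; simp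
    rcases neg_one_pow_eq_or ℝ k with h | h <;> rw [h] at h2 ⊢ <;> linarith
  simp [zsmul_eq_mul, hsign]

open Polynomial in
theorem exists_eval_sub_eval_eq_mul (f : ℝ[X]) (a : ℝ) {m : ℕ} (hm : 0 < m)
    (hf : f.natDegree ≤ m) :
    ∃ q : ℝ[X], q.natDegree < m ∧ ∀ x, f.eval x - f.eval a = (x - a) * q.eval x := by
  refine ⟨f /ₘ (X - C a), ?_, fun x => ?_⟩
  · rw [natDegree_divByMonic f (monic_X_sub_C a), natDegree_X_sub_C]
    omega
  · have h := congr_arg (eval x) (modByMonic_add_div f (X - C a))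
    rw [modByMonic_X_sub_C_eq_C_eval] at h
    simp only [eval_add, eval_C, eval_mul, eval_sub, eval_X] at h
    linarith

/-- Telescopes, since `1 / (t ^ 2 - 1 / 4) = 1 / (t - 1 / 2) - 1 / (t + 1 / 2)`. -/
theorem sum_inv_sq_sub_quarter (m n : ℕ) :
    ∑ k ∈ Finset.range n, (((k : ℝ) - m) ^ 2 - 1 / 4)⁻¹ =
      (-(m : ℝ) - 1 / 2)⁻¹ - ((n : ℝ) - m - 1 / 2)⁻¹ := by
  have hne : ∀ j : ℕ, (j : ℝ) - m - 1 / 2 ≠ 0 := by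
    intro j h
    have h2 : (2 * j : ℝ) = 2 * m + 1 := by linarith
    have h3 : 2 * j = 2 * m + 1 := by exact_mod_cast h2
    omega
  induction n with
  | zero => simp
  | succ n ih =>
    rw [Finset.sum_range_succ, ih]
    have h1 := hne n
    have h2 := hne (n + 1)
    push_cast at h2 ⊢
    have h3 : ((n : ℝ) - m) ^ 2 - 1 / 4 = (n - m - 1 / 2) * (n + 1 - m - 1 / 2) := by ring
    rw [h3, mul_inv]
    have h4 : ((n : ℝ) - m - 1 / 2)⁻¹ - ((n : ℝ) + 1 - m - 1 / 2)⁻¹ =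
        ((n : ℝ) - m - 1 / 2)⁻¹ * ((n : ℝ) + 1 - m - 1 / 2)⁻¹ := by
      rw [inv_sub_inv h1 h2, div_eq_mul_inv, mul_inv]
      ring
    linarith

/-- Only the term `k = m`, equal to `-4`, is negative, and the full sum is at most `0`. -/
theorem sum_erase_abs_inv_sq_sub_quarter_le (m : ℕ) :
    ∑ k ∈ (Finset.range (2 * m + 1)).erase m, |(((k : ℝ) - m) ^ 2 - 1 / 4)⁻¹| ≤ 4 := by
  have hmem : m ∈ Finset.range (2 * m + 1) := Finset.mem_range.2 (by omega)
  have h1 : ∑ k ∈ (Finset.range (2 * m + 1)).erase m, |(((k : ℝ) - m) ^ 2 - 1 / 4)⁻¹| =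
      ∑ k ∈ (Finset.range (2 * m + 1)).erase m, (((k : ℝ) - m) ^ 2 - 1 / 4)⁻¹ := by
    refine Finset.sum_congr rfl fun k hk => abs_of_nonneg (inv_nonneg.2 ?_)
    have := one_le_sq_natCast_sub (Finset.ne_of_mem_erase hk)
    linarith
  have h2 := Finset.add_sum_erase _ (fun k : ℕ => (((k : ℝ) - m) ^ 2 - 1 / 4)⁻¹) hmem
  rw [sum_inv_sq_sub_quarter] at h2
  rw [h1]
  have h3 : (-(m : ℝ) - 1 / 2)⁻¹ ≤ 0 := inv_nonpos.2 (by linarith [(m.cast_nonneg : (0 : ℝ) ≤ m)])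
  have h4 : 0 ≤ (((2 * m + 1 : ℕ) : ℝ) - m - 1 / 2)⁻¹ := by
    refine inv_nonneg.2 ?_
    push_cast
    linarith [(m.cast_nonneg : (0 : ℝ) ≤ m)]
  have h5 : (((m : ℝ) - m) ^ 2 - 1 / 4)⁻¹ = -4 := by norm_num
  linarith

open Polynomial in
/-- There is a finitely supported signed measure on `[0, m ^ 2]` that kills the polynomials of
degree at most `m`, although a quarter of its total variation sits at the origin, at distance at
least `1 / 4` from the rest. -/
theorem exists_annihilating_weights {m : ℕ} (hm : 0 < m) :
    ∃ (w x : Option (Fin (2 * m + 1)) → ℝ) (i₀ : Option (Fin (2 * m + 1))),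
      x i₀ = 0 ∧ (∀ i, 0 ≤ x i) ∧ (∀ i, i ≠ i₀ → 1 / 4 ≤ x i) ∧ (∀ i, x i ≤ (m : ℝ) ^ 2) ∧
      0 < w i₀ ∧ ∑ i, |w i| ≤ 4 * w i₀ ∧
      ∀ f : ℝ[X], f.natDegree ≤ m → ∑ i, w i * f.eval (x i) = 0 := by
  have hm1 : (1 : ℝ) ≤ m := by exact_mod_cast hm
  set A : ℝ := ((2 * m).choose m : ℝ) with hA
  have hApos : 0 < A := by
    rw [hA]; exact_mod_cast Nat.choose_pos (by omega : m ≤ 2 * m)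
  let y : ℕ → ℝ := fun k => ((k : ℝ) - m) ^ 2
  -- Dividing by `y k - 1 / 4` and adding a node at `1 / 4` of weight `-∑ a k` replaces `f` by the
  -- quotient `(f - f(1/4)) / (y - 1/4)`, of degree below `m`. The central weight is boosted to `4 *
  -- A`; the leading sign makes it positive.
  let a : ℕ → ℝ := fun k => (-1) ^ (m + 1) * ((-1) ^ k * (2 * m).choose k) * (y k - 1 / 4)⁻¹
  have hyne : ∀ k, y k - 1 / 4 ≠ 0 := by
    intro k
    rcases eq_or_ne k m with rfl | h
    · norm_num [y]
    · have := one_le_sq_natCast_sub h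
      exact (by simp only [y]; linarith : 0 < y k - 1 / 4).ne'
  have ham : a m = 4 * A := by
    have : (-1 : ℝ) ^ (m + 1) * (-1) ^ m = -1 := by
      rw [← pow_add, show m + 1 + m = 2 * m + 1 by ring, pow_succ, pow_mul]; simp
    simp only [a, y, ← mul_assoc, this]
    norm_num
    rw [← hA]; ring
  have hmem : m ∈ Finset.range (2 * m + 1) := Finset.mem_range.2 (by omega)
  -- The centre gives `4 * A`, the other `k` at most `4 * A`. The extra node costs at most `8 * A`
  -- more, so the total is at most `16 * A`, four times the central weight.
  have habs : ∑ k ∈ Finset.range (2 * m + 1), |a k| ≤ 8 * A := by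
    rw [← Finset.add_sum_erase _ _ hmem, ham, abs_of_pos (by linarith)]
    have h1 : ∑ k ∈ (Finset.range (2 * m + 1)).erase m, |a k| ≤
        ∑ k ∈ (Finset.range (2 * m + 1)).erase m, A * |(((k : ℝ) - m) ^ 2 - 1 / 4)⁻¹| := by
      refine Finset.sum_le_sum fun k _ => ?_
      simp only [a, abs_mul, abs_pow, abs_neg, abs_one, one_pow, one_mul, Nat.abs_cast]
      refine mul_le_mul_of_nonneg_right ?_ (abs_nonneg _)
      rw [hA, ← Nat.centralBinom_eq_two_mul_choose]
      exact_mod_cast Nat.choose_le_centralBinom k m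
    rw [← Finset.mul_sum] at h1
    nlinarith [sum_erase_abs_inv_sq_sub_quarter_le m]
  refine ⟨fun i => i.elim (-∑ k ∈ Finset.range (2 * m + 1), a k) fun k => a k,
    fun i => i.elim (1 / 4) fun k => y k, some ⟨m, by omega⟩, by simp [y], ?_, ?_, ?_, ?_, ?_, ?_⟩
  · rintro (_ | k)
    · norm_num
    · exact sq_nonneg _
  · rintro (_ | k) hk
    · exact le_rfl
    · have : (k : ℕ) ≠ m := fun h => hk (congr_arg some (Fin.ext h))
      have := one_le_sq_natCast_sub this
      simp only [Option.elim, y]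
      linarith
  · rintro (_ | k)
    · simp only [Option.elim]; nlinarith
    · simp only [Option.elim, y]
      have h1 : ((k : ℕ) : ℝ) ≤ 2 * m := by exact_mod_cast Nat.lt_succ_iff.1 k.2
      have h2 : (0 : ℝ) ≤ (k : ℕ) := Nat.cast_nonneg _
      nlinarith
  · simp only [Option.elim, ham]; linarith
  · rw [Fintype.sum_option]
    simp only [Option.elim, ham, abs_neg]
    rw [Fin.sum_univ_eq_sum_range fun k => |a k|]
    linarith [Finset.abs_sum_le_sum_abs a (Finset.range (2 * m + 1))]
  · intro f hf
    obtain ⟨q, hq, hfq⟩ := exists_eval_sub_eval_eq_mul f (1 / 4) hm hf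
    rw [Fintype.sum_option]
    simp only [Option.elim]
    rw [Fin.sum_univ_eq_sum_range fun k => a k * f.eval (y k), neg_mul, Finset.sum_mul,
      neg_add_eq_sub, ← Finset.sum_sub_distrib]
    rw [← mul_zero ((-1 : ℝ) ^ (m + 1)), ← sum_alternating_choose_eval_sq_eq_zero q hq,
      Finset.mul_sum]
    refine Finset.sum_congr rfl fun k _ => ?_
    rw [← mul_sub, hfq]
    have := hyne k
    have h1 : (y k - 1 / 4)⁻¹ * (y k - 1 / 4) = 1 := inv_mul_cancel₀ this
    simp only [a]
    linear_combination (-1) ^ (m + 1) * ((-1) ^ k * ((2 * m).choose k : ℝ)) * q.eval (y k) * h1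

/-! ### Mixtures and Bernoulli products on the torus. -/

/-- Finite mixtures of probability measures. -/
theorem exists_mixture {Ω ι : Type*} [MeasurableSpace Ω] [Fintype ι] (q : ι → ℝ)
    (hq : ∀ i, 0 ≤ q i) (hsum : ∑ i, q i = 1) (P : ι → ProbabilityMeasure Ω) :
    ∃ μ : ProbabilityMeasure Ω,
      (∀ f : Ω → ℂ, (∀ i, Integrable f (P i : Measure Ω)) →
        ∫ z, f z ∂(μ : Measure Ω) = ∑ i, (q i : ℂ) * ∫ z, f z ∂(P i : Measure Ω)) ∧
      ∀ s : Set Ω, (μ : Measure Ω).real s = ∑ i, q i * (P i : Measure Ω).real s := by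
  have hprob : IsProbabilityMeasure (∑ i, ENNReal.ofReal (q i) • (P i : Measure Ω)) := by
    constructor
    simp only [Measure.finsetSum_apply, Measure.smul_apply, measure_univ, smul_eq_mul, mul_one]
    rw [← ENNReal.ofReal_sum_of_nonneg fun i _ => hq i, hsum, ENNReal.ofReal_one]
  refine ⟨⟨_, hprob⟩, fun f hf => ?_, fun s => ?_⟩
  · rw [ProbabilityMeasure.coe_mk,
      integral_finsetSum_measure fun i _ => (hf i).smul_measure ENNReal.ofReal_ne_top]
    refine Finset.sum_congr rfl fun i _ => ?_
    rw [integral_smul_measure, ENNReal.toReal_ofReal (hq i), Complex.real_smul]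
  · rw [ProbabilityMeasure.coe_mk, Measure.real, Measure.finsetSum_apply,
      ENNReal.toReal_sum fun i _ => by
        exact ENNReal.mul_ne_top ENNReal.ofReal_ne_top (measure_ne_top _ _)]
    refine Finset.sum_congr rfl fun i _ => ?_
    simp [Measure.real, ENNReal.toReal_ofReal (hq i)]

/-- The distribution on the circle with mass `p` at `1 / 2` and mass `1 - p` at `0`. -/
noncomputable def halfBernoulli (p : ℝ) : Measure UnitAddCircle :=
  ENNReal.ofReal p • Measure.dirac ((1 / 2 : ℝ) : UnitAddCircle) +
    ENNReal.ofReal (1 - p) • Measure.dirac 0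

theorem isProbabilityMeasure_halfBernoulli {p : ℝ} (h0 : 0 ≤ p) (h1 : p ≤ 1) :
    IsProbabilityMeasure (halfBernoulli p) := by
  constructor
  simp only [halfBernoulli, Measure.add_apply, Measure.smul_apply, measure_univ, smul_eq_mul,
    mul_one]
  rw [← ENNReal.ofReal_add h0 (by linarith)]
  simp

theorem norm_coe_half : ‖((1 / 2 : ℝ) : UnitAddCircle)‖ = 1 / 2 := by
  simpa using AddCircle.norm_half_period_eq (1 : ℝ)

theorem fourier_coe_half (n : ℤ) :
    fourier n (((1 / 2 : ℝ) : UnitAddCircle)) = if Odd n then (-1 : ℂ) else 1 := by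
  rw [fourier_coe_apply, show 2 * (Real.pi : ℂ) * Complex.I * n * ((1 / 2 : ℝ) : ℂ) / (1 : ℝ) =
    n * (Real.pi * Complex.I) by push_cast; ring, Complex.exp_int_mul, Complex.exp_pi_mul_I]
  split_ifs with h
  · exact h.neg_one_zpow
  · exact (Int.not_odd_iff_even.1 h).neg_one_zpow

theorem integral_fourier_halfBernoulli {p : ℝ} (h0 : 0 ≤ p) (h1 : p ≤ 1) (n : ℤ) :
    ∫ z, fourier n z ∂halfBernoulli p = if Odd n then 1 - 2 * (p : ℂ) else 1 := by
  have hint : ∀ (a : UnitAddCircle) (r : ℝ),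
      Integrable (fun z => (fourier n z : ℂ)) (ENNReal.ofReal r • Measure.dirac a) := fun a r =>
    (integrable_dirac (by simp)).smul_measure ENNReal.ofReal_ne_top
  rw [halfBernoulli, integral_add_measure (hint _ _) (hint _ _), integral_smul_measure,
    integral_smul_measure, integral_dirac, integral_dirac, fourier_coe_half,
    ENNReal.toReal_ofReal h0, ENNReal.toReal_ofReal (by linarith), fourier_eval_zero]
  split_ifs
  · simp
    ring
  · simp

/-- The distribution on the torus with independent coordinates that are `1 / 2` with probability
`p` and `0` otherwise. -/
noncomputable def halfBernoulliPi (d : ℕ) (p : ℝ) : Measure (UnitAddTorus (Fin d)) :=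
  Measure.pi fun _ => halfBernoulli p

theorem isProbabilityMeasure_halfBernoulliPi (d : ℕ) {p : ℝ} (h0 : 0 ≤ p) (h1 : p ≤ 1) :
    IsProbabilityMeasure (halfBernoulliPi d p) := by
  have := isProbabilityMeasure_halfBernoulli h0 h1
  unfold halfBernoulliPi
  infer_instance

theorem integral_mFourier_halfBernoulliPi {d : ℕ} {p : ℝ} (h0 : 0 ≤ p) (h1 : p ≤ 1)
    (l : Fin d → ℤ) :
    ∫ z, UnitAddTorus.mFourier l z ∂halfBernoulliPi d p =
      (1 - 2 * (p : ℂ)) ^ (Finset.univ.filter fun i => Odd (l i)).card := by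
  have := isProbabilityMeasure_halfBernoulli h0 h1
  simp only [halfBernoulliPi, UnitAddTorus.mFourier, ContinuousMap.coe_mk]
  rw [integral_fintype_prod_eq_prod (fun i z => (fourier (l i) z : ℂ))]
  simp only [integral_fourier_halfBernoulli h0 h1, Finset.prod_ite, Finset.prod_const,
    one_pow, mul_one]

theorem halfBernoulli_real_of_half_notMem {p : ℝ} (h1 : p ≤ 1) {s : Set UnitAddCircle}
    (hs : MeasurableSet s) (h0 : 0 ∈ s) (hhalf : ((1 / 2 : ℝ) : UnitAddCircle) ∉ s) :
    (halfBernoulli p).real s = 1 - p := by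
  rw [Measure.real, halfBernoulli, Measure.add_apply, Measure.smul_apply, Measure.smul_apply,
    Measure.dirac_apply' _ hs, Measure.dirac_apply' _ hs, Set.indicator_of_mem h0,
    Set.indicator_of_notMem hhalf]
  simp [h1]

theorem halfBernoulliPi_real_pi {d : ℕ} {p : ℝ} (h0 : 0 ≤ p) (h1 : p ≤ 1) {s : Set UnitAddCircle}
    (hs : MeasurableSet s) (hmem : 0 ∈ s) (hhalf : ((1 / 2 : ℝ) : UnitAddCircle) ∉ s) :
    (halfBernoulliPi d p).real (Set.univ.pi fun _ => s) = (1 - p) ^ d := by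
  have := isProbabilityMeasure_halfBernoulli h0 h1
  rw [halfBernoulliPi, Measure.real, Measure.pi_pi, ENNReal.toReal_prod]
  change ∏ _i : Fin d, (halfBernoulli p).real s = _
  rw [halfBernoulli_real_of_half_notMem h1 hs hmem hhalf]
  simp

theorem torBall_subset_pi_closedBall {d : ℕ} (x : UnitAddTorus (Fin d)) (τ : ℝ) :
    torBall x τ ⊆ Set.univ.pi fun i => Metric.closedBall (x i) τ := by
  intro y hy i _
  rw [Metric.mem_closedBall, dist_comm]
  refine le_trans ?_ hy
  rw [← Real.sqrt_sq (dist_nonneg (x := x i) (y := y i))]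
  exact Real.sqrt_le_sqrt
    (Finset.single_le_sum (f := fun i => dist (x i) (y i) ^ 2) (fun i _ => sq_nonneg _)
      (Finset.mem_univ i))

theorem mem_torBall_self {d : ℕ} (x : UnitAddTorus (Fin d)) {τ : ℝ} (hτ : 0 ≤ τ) :
    x ∈ torBall x τ := by
  simpa [torBall, torDist] using hτ

/-- The ball lies between `{0}` and a box whose sides miss `1 / 2`; both have mass `(1 - p) ^ d`. -/
theorem halfBernoulliPi_real_torBall {d : ℕ} {p τ : ℝ} (h0 : 0 ≤ p) (h1 : p ≤ 1) (hτ : 0 ≤ τ)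
    (hτ' : τ < 1 / 2) : (halfBernoulliPi d p).real (torBall 0 τ) = (1 - p) ^ d := by
  have := isProbabilityMeasure_halfBernoulliPi d h0 h1
  have hhalf : ((1 / 2 : ℝ) : UnitAddCircle) ≠ 0 := by
    intro h
    have h2 := norm_coe_half
    rw [h, norm_zero] at h2
    norm_num at h2
  refine le_antisymm ?_ ?_
  · rw [← halfBernoulliPi_real_pi h0 h1 (Metric.isClosed_closedBall (x := 0) (ε := τ)).measurableSet
      (Metric.mem_closedBall_self hτ) (by rw [mem_closedBall_zero_iff, norm_coe_half]; linarith)]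
    exact measureReal_mono (torBall_subset_pi_closedBall 0 τ)
  · rw [← halfBernoulliPi_real_pi h0 h1 (measurableSet_singleton (0 : UnitAddCircle)) rfl hhalf]
    refine measureReal_mono fun y hy => ?_
    rw [show y = 0 from funext fun i => hy i (Set.mem_univ i)]
    exact mem_torBall_self 0 hτ

/-! ### The two distributions and the choice of constants. -/

/-- For every `m` with `16 * m ^ 2 ≤ d` there are two distributions on the torus with the same
Fourier coefficients at all frequencies with at most `m` odd entries, and whose masses near the
origin differ by a constant. -/
theorem exists_indistinguishable {d m : ℕ} (hm : 0 < m) (hd : 16 * m ^ 2 ≤ d) :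
    ∃ D₁ D₂ : ProbabilityMeasure (UnitAddTorus (Fin d)),
      (∀ l : Fin d → ℤ, (Finset.univ.filter fun i => Odd (l i)).card ≤ m →
        torFourierCoeff D₁ l = torFourierCoeff D₂ l) ∧
      ∀ τ₁ τ₂ : ℝ, 0 ≤ τ₁ → τ₁ < 1 / 2 → 0 ≤ τ₂ → τ₂ < 1 / 2 →
        (D₂ : Measure (UnitAddTorus (Fin d))).real (torBall 0 τ₂) + 1 / 5 ≤
          (D₁ : Measure (UnitAddTorus (Fin d))).real (torBall 0 τ₁) := by
  obtain ⟨w, x, i₀, hx0, hxnn, hxge, hxle, hw0, hwabs, hann⟩ := exists_annihilating_weights hm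
  have hdR : 16 * (m : ℝ) ^ 2 ≤ d := by exact_mod_cast hd
  have hm1 : (1 : ℝ) ≤ m := by exact_mod_cast hm
  have hdpos : (0 : ℝ) < d := by nlinarith
  -- The factor `16 / d` keeps `p ≤ 1` for nodes up to `m ^ 2`, and turns the gap `1 / 4` into `p *
  -- d ≥ 4`.
  set p : Option (Fin (2 * m + 1)) → ℝ := fun i => 16 / d * x i with hp
  have hp0 : ∀ i, 0 ≤ p i := fun i => mul_nonneg (by positivity) (hxnn i)
  have hp1 : ∀ i, p i ≤ 1 := by
    intro i
    rw [hp]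
    simp only
    rw [div_mul_eq_mul_div, div_le_one hdpos]
    linarith [hxle i]
  have hsum : ∑ i, w i = 0 := by simpa using hann 1 (by simp)
  set W : ℝ := ∑ i, (w i)⁺ with hW
  have hWneg : ∑ i, (w i)⁻ = W := by
    rw [eq_comm, ← sub_eq_zero, hW, ← Finset.sum_sub_distrib, ← hsum]
    exact Finset.sum_congr rfl fun i _ => posPart_sub_negPart (w i)
  have hWpos : 0 < W :=
    (posPart_pos hw0).trans_le
      (Finset.single_le_sum (f := fun i => (w i)⁺) (fun i _ => posPart_nonneg _)
        (Finset.mem_univ i₀))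
  have hWle : W ≤ 2 * w i₀ := by
    have : ∑ i, |w i| = W + W := by
      nth_rw 2 [← hWneg]
      rw [hW, ← Finset.sum_add_distrib]
      exact Finset.sum_congr rfl fun i _ => (posPart_add_negPart (w i)).symm
    linarith
  let P : Option (Fin (2 * m + 1)) → ProbabilityMeasure (UnitAddTorus (Fin d)) := fun i =>
    ⟨halfBernoulliPi d (p i), isProbabilityMeasure_halfBernoulliPi d (hp0 i) (hp1 i)⟩
  obtain ⟨D₁, hD₁, hD₁'⟩ := exists_mixture (fun i => (w i)⁺ / W)
    (fun i => div_nonneg (posPart_nonneg _) hWpos.le)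
    (by rw [← Finset.sum_div, div_self hWpos.ne']) P
  obtain ⟨D₂, hD₂, hD₂'⟩ := exists_mixture (fun i => (w i)⁻ / W)
    (fun i => div_nonneg (negPart_nonneg _) hWpos.le)
    (by rw [← Finset.sum_div, hWneg, div_self hWpos.ne']) P
  refine ⟨D₁, D₂, fun l hl => ?_, fun τ₁ τ₂ h10 h11 h20 h21 => ?_⟩
  · have hint : ∀ i, Integrable (fun z => UnitAddTorus.mFourier l z)
        (P i : Measure (UnitAddTorus (Fin d))) := fun i =>
      Integrable.of_bound (UnitAddTorus.mFourier l).continuous.aestronglyMeasurable 1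
        (Filter.Eventually.of_forall fun z =>
          ((UnitAddTorus.mFourier l).norm_coe_le_norm z).trans UnitAddTorus.mFourier_norm.le)
    unfold torFourierCoeff
    rw [hD₁ _ hint, hD₂ _ hint, ← sub_eq_zero, ← Finset.sum_sub_distrib]
    set n := (Finset.univ.filter fun i => Odd (l i)).card
    have hz := hann ((1 - Polynomial.C (2 * (16 / (d : ℝ))) * Polynomial.X) ^ n) (by
      refine Polynomial.natDegree_pow_le.trans ((Nat.mul_le_mul_left n ?_).trans
        ((mul_one n).le.trans hl))
      compute_degree)
    have hterm : ∀ i, ((((w i)⁺ / W : ℝ) : ℂ) * ∫ z, UnitAddTorus.mFourier l z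
          ∂(P i : Measure (UnitAddTorus (Fin d)))) - (((w i)⁻ / W : ℝ) : ℂ) *
          ∫ z, UnitAddTorus.mFourier l z ∂(P i : Measure (UnitAddTorus (Fin d))) =
        (((w i * ((1 - Polynomial.C (2 * (16 / (d : ℝ))) * Polynomial.X) ^ n).eval (x i)) / W : ℝ) :
          ℂ) := by
      intro i
      simp only [P, ProbabilityMeasure.coe_mk]
      rw [integral_mFourier_halfBernoulliPi (hp0 i) (hp1 i), ← sub_mul, ← Complex.ofReal_sub,
        ← sub_div, posPart_sub_negPart]
      simp [hp, n]
      ring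
    rw [Finset.sum_congr rfl fun i _ => hterm i, ← Complex.ofReal_sum, ← Finset.sum_div, hz]
    simp
  · rw [hD₁', hD₂']
    simp only [P, ProbabilityMeasure.coe_mk, halfBernoulliPi_real_torBall (hp0 _) (hp1 _) h10 h11,
      halfBernoulliPi_real_torBall (hp0 _) (hp1 _) h20 h21]
    rw [← le_sub_iff_add_le', ← Finset.sum_sub_distrib]
    have hsmall : ∀ i, i ≠ i₀ → (1 - p i) ^ d ≤ 1 / 5 := by
      intro i hi
      have h4 : 4 ≤ p i * d := by
        rw [hp]
        simp only
        rw [div_mul_eq_mul_div, div_mul_cancel₀ _ hdpos.ne']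
        linarith [hxge i hi]
      have h5 : (5 : ℝ) ≤ Real.exp 4 := by linarith [Real.add_one_le_exp (4 : ℝ)]
      calc (1 - p i) ^ d ≤ Real.exp (-p i) ^ d :=
            pow_le_pow_left₀ (by linarith [hp1 i]) (by linarith [Real.add_one_le_exp (-p i)]) d
        _ = Real.exp (-(p i * d)) := by rw [← Real.exp_nat_mul]; ring_nf
        _ ≤ Real.exp (-4) := Real.exp_le_exp.2 (by linarith)
        _ = 1 / Real.exp 4 := by rw [Real.exp_neg, one_div]
        _ ≤ 1 / 5 := one_div_le_one_div_of_le (by norm_num) h5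
    have hrest : -(3 / 5 * w i₀) ≤ ∑ i ∈ Finset.univ.erase i₀, w i * (1 - p i) ^ d := by
      have h1 := Finset.add_sum_erase _ (fun i => |w i|) (Finset.mem_univ i₀)
      rw [abs_of_pos hw0] at h1
      have h2 : ∑ i ∈ Finset.univ.erase i₀, -(1 / 5 * |w i|) ≤
          ∑ i ∈ Finset.univ.erase i₀, w i * (1 - p i) ^ d := by
        refine Finset.sum_le_sum fun i hi => ?_
        have h3 := hsmall i (Finset.ne_of_mem_erase hi)
        have h4 : 0 ≤ (1 - p i) ^ d := pow_nonneg (by linarith [hp1 i]) d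
        nlinarith [abs_nonneg (w i), neg_abs_le (w i)]
      rw [Finset.sum_neg_distrib, ← Finset.mul_sum] at h2
      linarith
    -- The atom at `0` contributes `w i₀`; the rest, of total variation at most `3 * w i₀`, loses at
    -- most a fifth of that. Dividing by `W ≤ 2 * w i₀` leaves `1 / 5`.
    have htotal : 2 / 5 * w i₀ ≤ ∑ i, w i * (1 - p i) ^ d := by
      rw [← Finset.add_sum_erase _ _ (Finset.mem_univ i₀)]
      have : p i₀ = 0 := by simp [hp, hx0]
      rw [this]
      simp only [sub_zero, one_pow, mul_one]
      linarith
    have hdiff : ∑ i, ((w i)⁺ / W * (1 - p i) ^ d - (w i)⁻ / W * (1 - p i) ^ d) =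
        (∑ i, w i * (1 - p i) ^ d) / W := by
      rw [Finset.sum_div]
      refine Finset.sum_congr rfl fun i _ => ?_
      rw [← sub_mul, ← sub_div, posPart_sub_negPart]
      ring
    rw [hdiff, le_div_iff₀ hWpos]
    linarith

theorem card_filter_odd_le_sum_abs {ι : Type*} [Fintype ι] (l : ι → ℤ) :
    ((Finset.univ.filter fun i => Odd (l i)).card : ℝ) ≤ ∑ i, |(l i : ℝ)| := by
  rw [Finset.card_filter, Nat.cast_sum]
  refine Finset.sum_le_sum fun i _ => ?_
  split_ifs with h
  · have : 1 ≤ |l i| := Int.one_le_abs fun h0 => by simp [h0] at h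
    rw [Nat.cast_one]
    exact_mod_cast this
  · simp

theorem theorem6p1 :
    ∃ c : ℝ, 0 < c ∧ ∃ C : ℝ, 0 < C ∧
      ∀ (d : ℕ) (ε : ℝ), (2 : ℝ) ^ (-(d : ℝ) / 3) < ε → ε < 1 / 170 →
        ∃ D₁ D₂ : ProbabilityMeasure (UnitAddTorus (Fin d)),
          (∀ l : Fin d → ℤ,
            (∑ i, |(l i : ℝ)|) ≤ c * Real.sqrt ((d : ℝ) / Real.log (1 / ε)) →
              ‖torFourierCoeff D₁ l - torFourierCoeff D₂ l‖ ≤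
                (2 : ℝ) ^ (-(C * Real.sqrt ((d : ℝ) * Real.log (1 / ε))))) ∧
          ε < heavyHitterDist (49 / 100) D₁ D₂ := by
  -- As the coefficients agree exactly, any `C > 0` would do; `c = 1 / 4` matches `m = ⌊√(d / 16)⌋`.
  refine ⟨1 / 4, by norm_num, 1, one_pos, fun d ε hε hε' => ?_⟩
  have hεpos : 0 < ε := lt_trans (by positivity) hε
  -- For `d ≤ 15`, `ε` would exceed `2 ^ (-5) = 1 / 32`.
  have hd : 16 ≤ d := by
    by_contra! h
    have h1 : (2 : ℝ) ^ (-5 : ℝ) ≤ (2 : ℝ) ^ (-(d : ℝ) / 3) := by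
      refine Real.rpow_le_rpow_of_exponent_le (by norm_num) ?_
      have : (d : ℝ) ≤ 15 := by exact_mod_cast Nat.lt_succ_iff.1 h
      linarith
    rw [Real.rpow_neg (by norm_num)] at h1
    norm_num at h1
    linarith
  have hlog : 1 ≤ Real.log (1 / ε) := by
    rw [Real.le_log_iff_exp_le (by positivity), le_div_iff₀ hεpos]
    nlinarith [Real.exp_one_lt_d9, Real.exp_pos 1]
  obtain ⟨D₁, D₂, hF, hmass⟩ := exists_indistinguishable (d := d) (m := Nat.sqrt (d / 16))
    (Nat.sqrt_pos.2 (by omega)) (by have := Nat.sqrt_le' (d / 16); omega)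
  refine ⟨D₁, D₂, fun l hl => ?_, ?_⟩
  · rw [hF l, sub_self, norm_zero]
    · positivity
    · have h1 := (card_filter_odd_le_sum_abs l).trans hl
      set n := (Finset.univ.filter fun i => Odd (l i)).card
      have h2 : Real.sqrt ((d : ℝ) / Real.log (1 / ε)) ≤ Real.sqrt d :=
        Real.sqrt_le_sqrt (div_le_self (Nat.cast_nonneg d) hlog)
      have h3 : (4 * n : ℝ) ≤ Real.sqrt d := by linarith
      have h4 : (4 * n : ℝ) ^ 2 ≤ d := by
        rwa [Real.le_sqrt (by positivity) (Nat.cast_nonneg d)] at h3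
      have h5 : (4 * n) ^ 2 ≤ d := by exact_mod_cast h4
      rw [Nat.le_sqrt', Nat.le_div_iff_mul_le (by norm_num)]
      nlinarith
  -- Centre `0` and `τ = 0` suffice: the enlarged radius `0.49` is still below `1 / 2`.
  · have h1 := ((isLeast_heavyHitterDist (49 / 100) D₁ D₂).1.2 0 le_rfl (by norm_num) 0).1
    have h2 := hmass 0 (0 + 49 / 100) le_rfl (by norm_num) (by norm_num) (by norm_num)
    linarith
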